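/- Let $d\ge 0$ and let $\mu$ be a Borel probability measure on $\mathbb{R}^d$ (Euclidean norm) whose support $\operatorname{supp}\mu$ is compact. Write $B(x,r)$ for the open ball and use the following notions, with values in $[0,\infty]$ unless said otherwise and with $\inf\emptyset=\infty$. * Upper regularity dimension: $\overline{\dim}_{\mathrm{reg}}\,\mu$ is the infimum of all $s\ge 0$ for which there is $C>0$ with $\frac{\mu(B(x,R))}{\mu(B(x,r))}\le C\left(\frac Rr\right)^s$ for all $0<r<R$ and all $x\in\operatorname{supp}\mu$. * Upper local dimension at $x$: $\overline{\dim}_{\mathrm{loc}}(x,\mu)=\limsup_{r\to0}\frac{\log\mu(B(x,r))}{\log r}$. Upper packing dimension of $\mu$: $\overline{\dim}_{\mathrm P}\,\mu$ is the $\mu$-essential supremum of $\overline{\dim}_{\mathrm{loc}}(x,\mu)$ over $x\in\operatorname{supp}\mu$. * For $q\in\mathbb{R}$ and $r>0$ let $M_r^q(\mu)=\sup\sum_i\mu(B(x_i,r))^q$, the supremum being over all finite families of points $x_i\in\operatorname{supp}\mu$ with $|x_i-x_j|>2r$ for $i\ne j$. The lower $L^q$-spectrum is $\underline\tau(q)=\liminf_{r\to0}\frac{\log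 M_r^q(\mu)}{\log r}\in[-\infty,\infty]$, and the top of the spectrum is $T(\mu)=\sup\{s\ge0:\ \underline\tau(q)<sq\ \text{ for all } q<0\}$, with $\sup\emptyset=0$. * Packing dimension of a set $F$: $\dim_{\mathrm P}F=\inf\{s\ge0:\mathcal P^s(F)=0\}$, where $\mathcal P^s(F)=\inf\{\sum_{i}\mathcal P^s_0(E_i): F\subseteq\bigcup_{i\in\mathbb N}E_i\}$ is the packing measure and $\mathcal P_0^s(E)=\lim_{\delta\to0}\sup\sum_i(2r_i)^s$, the supremum being over finite families of pairwise disjoint closed balls with centres in $E$ and radii $0<r_i\le\delta$. * Assouad dimension of a set $F$: $\dim_{\mathrm A}F$ is the infimum of all $s\ge0$ for which there is $C>0$ such that, for all $0<r<R$ and $x\in F$, the set $F\cap B(x,R)$ can be covered by at most $C(R/r)^s$ closed balls of radius $r$. Then $$\overline{\dim}_{\mathrm P}\,\mu\ \le\ \sup_{x\in\operatorname{supp}\mu}\overline{\dim}_{\mathrm{loc}}(x,\mu)\ \le\ T(\mu)\ \le\ \overline{\dim}_{\mathrm{reg}}\,\mu$$ and $$\overline{\dim}_{\mathrm P}\,\mu\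 \le\ \dim_{\mathrm P}\operatorname{supp}\mu\ \le\ \dim_{\mathrm A}\operatorname{supp}\mu\ \le\ \overline{\dim}_{\mathrm{reg}}\,\mu .$$ -/

import Mathlib

open MeasureTheory Metric Set Filter Topology
open scoped NNReal ENNReal

noncomputable section

/-- The upper regularity dimension of a measure, with values in `[0, ∞]` and `inf ∅ = ∞`.
Balls are open balls of the ambient space. -/
def upperRegDim {X : Type*} [PseudoMetricSpace X] [MeasurableSpace X] (μ : Measure X) : ℝ≥0∞ :=
  ⨅ (s : ℝ≥0) (_ : ∃ C : ℝ, 0 < C ∧ ∀ r R : ℝ, 0 < r → r < R → ∀ x ∈ μ.support,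
    μ (ball x R) / μ (ball x r) ≤ ENNReal.ofReal (C * (R / r) ^ (s : ℝ))), (s : ℝ≥0∞)

/-- The upper local dimension of `μ` at `x`:
the upper limit of `log μ(B(x,r)) / log r` as `r ↓ 0`, in the extended reals. -/
def upperLocalDim {X : Type*} [PseudoMetricSpace X] [MeasurableSpace X] (μ : Measure X)
    (x : X) : EReal :=
  limsup (fun r : ℝ => ENNReal.log (μ (ball x r)) / ((Real.log r : ℝ) : EReal)) (𝓝[>] (0 : ℝ))

/-- The upper packing dimension of `μ`: the essential supremum over the support of `μ` of its
upper local dimension. -/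
def upperPackingDimMeasure {X : Type*} [PseudoMetricSpace X] [MeasurableSpace X]
    (μ : Measure X) : EReal :=
  essSup (upperLocalDim μ) (μ.restrict μ.support)

/-- The multifractal packing function `M_r^q(μ)`. The centres of a packing lie in the support of
`μ`. Packings are finite, which does not restrict the supremum of the sums (all terms are
nonnegative, so a countable sum is the supremum of its finite partial sums). -/
def multifractalPacking {X : Type*} [PseudoMetricSpace X] [MeasurableSpace X] (μ : Measure X)
    (q r : ℝ) : ℝ≥0∞ :=
  ⨆ (S : Finset X) (_ : (S : Set X) ⊆ μ.support)
    (_ : (S : Set X).Pairwise fun x y => 2 * r < dist x y), ∑ x ∈ S, μ (ball x r) ^ q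

/-- The lower `L^q`-spectrum of `μ`, with values in the extended reals. -/
def lowerLqSpectrum {X : Type*} [PseudoMetricSpace X] [MeasurableSpace X] (μ : Measure X)
    (q : ℝ) : EReal :=
  liminf (fun r : ℝ => ENNReal.log (multifractalPacking μ q r) / ((Real.log r : ℝ) : EReal))
    (𝓝[>] (0 : ℝ))

/-- The top of the `L^q`-spectrum: the supremum in `[0, ∞]` (so that `sup ∅ = 0`) of all `s ≥ 0`
with `τ(q) < s q` for every `q < 0`. -/
def topOfSpectrum {X : Type*} [PseudoMetricSpace X] [MeasurableSpace X] (μ : Measure X) : ℝ≥0∞ :=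
  ⨆ (s : ℝ≥0) (_ : ∀ q : ℝ, q < 0 → lowerLqSpectrum μ q < (((s : ℝ) * q : ℝ) : EReal)),
    (s : ℝ≥0∞)

/-- The supremum of `∑ (2 rᵢ) ^ s` over packings of `F` by pairwise disjoint closed balls
`B(xᵢ, rᵢ)` with centres in `F` and radii `0 < rᵢ ≤ δ`. -/
def packingPreAt {X : Type*} [PseudoMetricSpace X] (s δ : ℝ) (F : Set X) : ℝ≥0∞ :=
  ⨆ (P : Finset (X × ℝ)) (_ : ∀ p ∈ P, p.1 ∈ F ∧ 0 < p.2 ∧ p.2 ≤ δ)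
    (_ : (P : Set (X × ℝ)).Pairwise
      fun p p' => Disjoint (closedBall p.1 p.2) (closedBall p'.1 p'.2)),
    ∑ p ∈ P, ENNReal.ofReal ((2 * p.2) ^ s)

/-- The `s`-dimensional packing premeasure: the limit of `packingPreAt s δ F` as `δ ↓ 0`, which is
an infimum since that quantity increases with `δ`. -/
def packingPremeasure {X : Type*} [PseudoMetricSpace X] (s : ℝ) (F : Set X) : ℝ≥0∞ :=
  ⨅ (δ : ℝ) (_ : 0 < δ), packingPreAt s δ F

/-- The `s`-dimensional packing measure of a set. -/
def packingMeasure {X : Type*} [PseudoMetricSpace X] (s : ℝ) (F : Set X) : ℝ≥0∞ :=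
  ⨅ (E : ℕ → Set X) (_ : F ⊆ ⋃ i, E i), ∑' i, packingPremeasure s (E i)

/-- The packing dimension of a set. -/
def packingDim {X : Type*} [PseudoMetricSpace X] (F : Set X) : ℝ≥0∞ :=
  ⨅ (s : ℝ≥0) (_ : packingMeasure (s : ℝ) F = 0), (s : ℝ≥0∞)

/-- The Assouad dimension of a set. The covering number counts the closed balls of radius `r`
needed to cover `F ∩ B(x,R)`; taking open balls, or sets of diameter at most `r`, instead only
changes the constant `C`. -/
def assouadDim {X : Type*} [PseudoMetricSpace X] (F : Set X) : ℝ≥0∞ :=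
  ⨅ (s : ℝ≥0) (_ : ∃ C : ℝ, 0 < C ∧ ∀ r R : ℝ, 0 < r → r < R → ∀ x ∈ F,
    ((externalCoveringNumber r.toNNReal (F ∩ ball x R) : ℕ∞) : ℝ≥0∞)
      ≤ ENNReal.ofReal (C * (R / r) ^ (s : ℝ))), (s : ℝ≥0∞)

end

/-! Two mechanisms carry the chains. First, mass counting. A one-point packing at `x` shows that the
spectrum sees every local dimension. Conversely, the regularity condition with exponent `s` gives
`μ(B(x,r)) ≥ A r^s` uniformly on the bounded support, so a packing has at most `(A r^s)⁻¹` balls and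
`M_r^q ≤ (A r^s)^(q-1)`. Thus `τ(q) ≥ s(q-1)`, and letting `q → -∞` excludes slopes above `s`. The
same counting inside one ball bounds the Assouad dimension (`card_mul_le_measureReal`). Second,
packings. Vitali's lemma bounds the mass of a set where the local dimension exceeds `s` by its
`s`-packing measure, so that set is null once the packing measure of the support vanishes. Sorting a
packing by dyadic radius bounds it by covering numbers, and the sum over scales is geometric above
the Assouad exponent. -/

/-! ### Logarithmic quotients and extended reals; `log r < 0` reverses inequalities. -/

theorem lt_log_div_log_iff {a : ℝ≥0∞} {r s : ℝ} (hr : 0 < r) (hr1 : r < 1) :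
    (s : EReal) < ENNReal.log a / ((Real.log r : ℝ) : EReal) ↔ a < ENNReal.ofReal (r ^ s) := by
  have hL : Real.log r < 0 := Real.log_neg hr hr1
  have hs : (s : EReal) = ((s * Real.log r : ℝ) : EReal) / ((Real.log r : ℝ) : EReal) := by
    rw [← EReal.coe_div, mul_div_cancel_right₀ _ hL.ne]
  rw [hs, (EReal.strictAnti_div_right_of_neg (by exact_mod_cast hL)
    (EReal.coe_ne_bot _)).lt_iff_gt, ← Real.log_rpow hr,
    ← ENNReal.log_ofReal_of_pos (Real.rpow_pos_of_pos hr s), ENNReal.log_lt_log_iff]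

theorem log_div_log_lt_iff {a : ℝ≥0∞} {r s : ℝ} (hr : 0 < r) (hr1 : r < 1) :
    ENNReal.log a / ((Real.log r : ℝ) : EReal) < (s : EReal) ↔ ENNReal.ofReal (r ^ s) < a := by
  have hL : Real.log r < 0 := Real.log_neg hr hr1
  have hs : (s : EReal) = ((s * Real.log r : ℝ) : EReal) / ((Real.log r : ℝ) : EReal) := by
    rw [← EReal.coe_div, mul_div_cancel_right₀ _ hL.ne]
  rw [hs, (EReal.strictAnti_div_right_of_neg (by exact_mod_cast hL)
    (EReal.coe_ne_bot _)).lt_iff_gt, ← Real.log_rpow hr,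
    ← ENNReal.log_ofReal_of_pos (Real.rpow_pos_of_pos hr s), ENNReal.log_lt_log_iff]

theorem le_log_div_log_iff {a : ℝ≥0∞} {r s : ℝ} (hr : 0 < r) (hr1 : r < 1) :
    (s : EReal) ≤ ENNReal.log a / ((Real.log r : ℝ) : EReal) ↔ a ≤ ENNReal.ofReal (r ^ s) := by
  simpa using (log_div_log_lt_iff (a := a) (s := s) hr hr1).not

/-- Since `x` may be negative, it is first replaced by `max 0 x`, which lives in `ℝ≥0∞`, where the
infimum is taken. -/
theorem EReal.le_coe_iInf_of_forall {x : EReal} {p : ℝ≥0 → Prop}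
    (h : ∀ s, p s → x ≤ ((s : ℝ) : EReal)) :
    x ≤ ((⨅ (s : ℝ≥0) (_ : p s), (s : ℝ≥0∞) : ℝ≥0∞) : EReal) := by
  refine ((le_max_right 0 x).trans_eq EReal.coe_toENNReal_eq_max.symm).trans (EReal.coe_ennreal_le_coe_ennreal_iff.2 ?_)
  refine le_iInf₂ fun s hs => ?_
  have := EReal.toENNReal_le_toENNReal (h s hs)
  simpa using this

theorem ENNReal.rpow_lt_rpow_of_neg {x y : ℝ≥0∞} {z : ℝ} (hxy : x < y) (hz : z < 0) :
    y ^ z < x ^ z := by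
  rw [← neg_neg z, ENNReal.rpow_neg y, ENNReal.rpow_neg x, ENNReal.inv_lt_inv]
  exact ENNReal.rpow_lt_rpow hxy (neg_pos.2 hz)

theorem ENNReal.rpow_le_rpow_of_nonpos {x y : ℝ≥0∞} {z : ℝ} (hxy : x ≤ y) (hz : z ≤ 0) :
    y ^ z ≤ x ^ z := by
  rw [← neg_neg z, ENNReal.rpow_neg y, ENNReal.rpow_neg x, ENNReal.inv_le_inv]
  exact ENNReal.rpow_le_rpow hxy (neg_nonneg.2 hz)

/-! ### Ball masses: local dimension, spectrum, regularity, Assouad dimension -/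

section Metric

variable {X : Type*} [PseudoMetricSpace X] [MeasurableSpace X] {μ : Measure X}

theorem measure_ball_pos_of_mem_support {x : X} (hx : x ∈ μ.support) {r : ℝ} (hr : 0 < r) :
    0 < μ (ball x r) :=
  (Measure.mem_support_iff_forall x).1 hx _ (ball_mem_nhds x hr)

/-- The local dimension exceeds `s` only if arbitrarily small balls have mass below `r ^ s`. -/
theorem exists_ball_lt_rpow {x : X} {s : ℝ} (h : (s : EReal) < upperLocalDim μ x) {δ : ℝ}
    (hδ : 0 < δ) : ∃ r, 0 < r ∧ r < δ ∧ r < 1 ∧ μ (ball x r) < ENNReal.ofReal (r ^ s) := by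
  have h1 := frequently_lt_of_lt_limsup (by isBoundedDefault) h
  have h2 : ∀ᶠ r : ℝ in 𝓝[>] 0, r ∈ Ioo 0 (min δ 1) :=
    Ioo_mem_nhdsGT (lt_min hδ one_pos)
  obtain ⟨r, hr, hr'⟩ := (h1.and_eventually h2).exists
  have hr1 : r < 1 := hr'.2.trans_le (min_le_right _ _)
  exact ⟨r, hr'.1, hr'.2.trans_le (min_le_left _ _), hr1, (lt_log_div_log_iff hr'.1 hr1).1 hr⟩

theorem measure_ball_rpow_le_multifractalPacking {x : X} (hx : x ∈ μ.support) (q r : ℝ) :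
    μ (ball x r) ^ q ≤ multifractalPacking μ q r := by
  unfold multifractalPacking
  refine le_iSup_of_le {x} (le_iSup_of_le (by simpa using hx) (le_iSup_of_le (by simp) ?_))
  simp

theorem upperLocalDim_le_topOfSpectrum {x : X} (hx : x ∈ μ.support) :
    upperLocalDim μ x ≤ (topOfSpectrum μ : EReal) := by
  by_contra! hlt
  obtain ⟨t, ht1, ht2⟩ := EReal.lt_iff_exists_real_btwn.1 hlt
  -- The second exponent makes `τ(q) ≤ t' q < t q` strict, as admissibility of `t` requires.
  obtain ⟨t', htt', ht'⟩ := EReal.lt_iff_exists_real_btwn.1 ht2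
  have htt : t < t' := by exact_mod_cast htt'
  have ht0 : 0 ≤ t := by
    have : (0 : EReal) < t := (EReal.coe_ennreal_nonneg _).trans_lt ht1
    exact_mod_cast this.le
  refine ht1.not_ge ?_
  lift t to ℝ≥0 using ht0
  have key : (t : ℝ≥0∞) ≤ topOfSpectrum μ := by
    unfold topOfSpectrum
    refine le_iSup₂_of_le (f := fun (s : ℝ≥0) _ => (s : ℝ≥0∞)) t
      (fun q hq => ?_) le_rfl
    have hle : lowerLqSpectrum μ q ≤ ((t' * q : ℝ) : EReal) := by
      refine liminf_le_of_frequently_le' ?_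
      have h1 := frequently_lt_of_lt_limsup (by isBoundedDefault) ht'
      have h2 : ∀ᶠ r : ℝ in 𝓝[>] 0, r ∈ Ioo 0 1 := Ioo_mem_nhdsGT one_pos
      refine (h1.and_eventually h2).mono ?_
      rintro r ⟨hr, hr0, hr1⟩
      rw [lt_log_div_log_iff hr0 hr1] at hr
      refine ((log_div_log_lt_iff hr0 hr1).2 ?_).le
      refine lt_of_lt_of_le ?_ (measure_ball_rpow_le_multifractalPacking hx q r)
      rw [Real.rpow_mul hr0.le, ← ENNReal.ofReal_rpow_of_pos (Real.rpow_pos_of_pos hr0 _)]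
      exact ENNReal.rpow_lt_rpow_of_neg hr hq
    refine hle.trans_lt ?_
    exact_mod_cast mul_lt_mul_of_neg_right htt hq
  have := EReal.coe_ennreal_le_coe_ennreal_iff.2 key
  exact this

/-- The defining condition of the upper regularity dimension, as a lower bound for small balls. -/
theorem measure_ball_le_mul_of_div_le [IsProbabilityMeasure μ] {C s : ℝ}
    (h : ∀ r R : ℝ, 0 < r → r < R → ∀ x ∈ μ.support,
      μ (ball x R) / μ (ball x r) ≤ ENNReal.ofReal (C * (R / r) ^ s))
    {r R : ℝ} (hr : 0 < r) (hrR : r < R) {x : X} (hx : x ∈ μ.support) :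
    μ.real (ball x R) ≤ C * (R / r) ^ s * μ.real (ball x r) := by
  have hpos := measure_ball_pos_of_mem_support hx hr
  have h1 := (ENNReal.div_le_iff hpos.ne' (measure_ne_top _ _)).1 (h r R hr hrR x hx)
  have hR := measure_ball_pos_of_mem_support hx (hr.trans hrR)
  have hC : 0 ≤ C * (R / r) ^ s := by
    by_contra! hneg
    rw [ENNReal.ofReal_of_nonpos hneg.le, zero_mul] at h1
    exact hR.not_ge h1
  have h2 := ENNReal.toReal_mono
    (ENNReal.mul_ne_top ENNReal.ofReal_ne_top (measure_ne_top _ _)) h1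
  rwa [ENNReal.toReal_mul, ENNReal.toReal_ofReal hC] at h2

theorem card_mul_le_measureReal [OpensMeasurableSpace X] [IsFiniteMeasure μ] {S : Finset X}
    {ρ m : ℝ} {A : Set X} (hsep : (S : Set X).Pairwise fun x y => 2 * ρ ≤ dist x y)
    (hsub : ∀ x ∈ S, ball x ρ ⊆ A) (hm : ∀ x ∈ S, m ≤ μ.real (ball x ρ)) :
    (S.card : ℝ) * m ≤ μ.real A := by
  have hdisj : (S : Set X).PairwiseDisjoint fun x => ball x ρ := fun x hx y hy hxy =>
    ball_disjoint_ball (by linarith [hsep hx hy hxy])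
  calc (S.card : ℝ) * m = ∑ _x ∈ S, m := by simp
    _ ≤ ∑ x ∈ S, μ.real (ball x ρ) := Finset.sum_le_sum hm
    _ = μ.real (⋃ x ∈ S, ball x ρ) :=
      (measureReal_biUnion_finset hdisj fun _ _ => measurableSet_ball).symm
    _ ≤ μ.real A := measureReal_mono (iUnion₂_subset hsub)

theorem measureReal_ball_eq_one [HereditarilyLindelofSpace X] [IsProbabilityMeasure μ] {x : X}
    {R : ℝ} (h : μ.support ⊆ ball x R) : μ.real (ball x R) = 1 := by
  have : ball x R ∈ ae μ := mem_of_superset Measure.support_mem_ae h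
  rw [measureReal_def, measure_congr (eventuallyEq_univ.2 this)]
  simp

theorem topOfSpectrum_le_upperRegDim [OpensMeasurableSpace X] [HereditarilyLindelofSpace X]
    [IsProbabilityMeasure μ] (hb : Bornology.IsBounded μ.support) :
    topOfSpectrum μ ≤ upperRegDim μ := by
  refine le_iInf₂ fun s ⟨C, hC, h⟩ => iSup₂_le fun t ht => ENNReal.coe_le_coe.2 ?_
  by_contra! hst
  obtain ⟨c, hc⟩ := Measure.nonempty_support (IsProbabilityMeasure.ne_zero μ)
  obtain ⟨R₀, hR₀, hsub⟩ := hb.subset_ball_lt 0 c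
  have hsub' : ∀ x ∈ μ.support, μ.support ⊆ ball x (2 * R₀) := fun x hx =>
    hsub.trans (ball_subset_ball' (by have := hsub hx; rw [mem_ball, dist_comm] at this; linarith))
  set R := 2 * R₀ with hR
  have hR0 : 0 < R := by positivity
  set A := (C * R ^ (s : ℝ))⁻¹ with hA
  have hA0 : 0 < A := by positivity
  have hball : ∀ r, 0 < r → r < R → ∀ x ∈ μ.support,
      A * r ^ (s : ℝ) ≤ μ.real (ball x r) := fun r hr hrR x hx => by
    have := measure_ball_le_mul_of_div_le h hr hrR hx
    rw [measureReal_ball_eq_one (hsub' x hx), Real.div_rpow hR0.le hr.le] at this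
    have h2 : A * r ^ (s : ℝ) * 1 ≤
        A * r ^ (s : ℝ) * (C * (R ^ (s : ℝ) / r ^ (s : ℝ)) * μ.real (ball x r)) := by gcongr
    refine (mul_one (A * r ^ (s : ℝ)) ▸ h2).trans_eq ?_
    rw [hA]
    have : 0 < R ^ (s : ℝ) := by positivity
    have : 0 < r ^ (s : ℝ) := by positivity
    field_simp
  have hM : ∀ q r : ℝ, q < 0 → 0 < r → r < R →
      multifractalPacking μ q r ≤ ENNReal.ofReal ((A * r ^ (s : ℝ)) ^ (q - 1)) := by
    intro q r hq hr hrR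
    have hm0 : 0 < A * r ^ (s : ℝ) := by positivity
    refine iSup_le fun S => iSup₂_le fun hS hsep => ?_
    have hcard : (S.card : ℝ) * (A * r ^ (s : ℝ)) ≤ 1 :=
      (card_mul_le_measureReal (A := univ) (fun x hx y hy hxy => (hsep hx hy hxy).le)
        (fun x _ => subset_univ _) (fun x hx => hball r hr hrR x (hS hx))).trans_eq (by simp)
    calc ∑ x ∈ S, μ (ball x r) ^ q
        ≤ ∑ x ∈ S, ENNReal.ofReal ((A * r ^ (s : ℝ)) ^ q) := by
          refine Finset.sum_le_sum fun x hx => ?_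
          rw [← ENNReal.ofReal_rpow_of_pos hm0]
          refine ENNReal.rpow_le_rpow_of_nonpos ?_ hq.le
          rw [ENNReal.ofReal_le_iff_le_toReal (measure_ne_top _ _)]
          exact hball r hr hrR x (hS hx)
      _ = ENNReal.ofReal (S.card * (A * r ^ (s : ℝ)) ^ q) := by
          rw [Finset.sum_const, nsmul_eq_mul, ENNReal.ofReal_mul (by positivity),
            ENNReal.ofReal_natCast]
      _ ≤ ENNReal.ofReal ((A * r ^ (s : ℝ)) ^ (q - 1)) := by
          refine ENNReal.ofReal_le_ofReal ?_
          rw [Real.rpow_sub_one hm0.ne', le_div_iff₀ hm0, mul_right_comm]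
          exact mul_le_of_le_one_left (by positivity) hcard
  have hst' : (0 : ℝ) < t - s := sub_pos.2 (by exact_mod_cast hst)
  -- The value of `q` at which `s(q-1) - 1 = t q`, so admissibility of `t` fails. The extra `-1`
  -- leaves a factor `r` to absorb the constant `A^(q-1)`.
  set q : ℝ := -((s + 1) / (t - s)) with hq
  have hq0 : q < 0 := neg_lt_zero.2 (by positivity)
  have hlow : (((s : ℝ) * (q - 1) - 1 : ℝ) : EReal) ≤ lowerLqSpectrum μ q := by
    refine le_liminf_of_le (by isBoundedDefault) ?_
    have hev : ∀ᶠ r : ℝ in 𝓝[>] 0, r ∈ Ioo 0 (min (min 1 R) (A ^ (1 - q))) :=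
      Ioo_mem_nhdsGT (by positivity)
    filter_upwards [hev] with r ⟨hr, hr'⟩
    obtain ⟨⟨hr1, hrR⟩, hrA⟩ : (r < 1 ∧ r < R) ∧ r < A ^ (1 - q) := by simpa using hr'
    rw [le_log_div_log_iff hr hr1]
    refine (hM q r hq0 hr hrR).trans (ENNReal.ofReal_le_ofReal ?_)
    rw [Real.mul_rpow hA0.le (by positivity), ← Real.rpow_mul hr.le, Real.rpow_sub_one hr.ne',
      le_div_iff₀ hr, mul_right_comm]
    refine mul_le_of_le_one_left (by positivity) ?_
    calc A ^ (q - 1) * r ≤ A ^ (q - 1) * A ^ (1 - q) := by gcongr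
      _ = 1 := by rw [← Real.rpow_add hA0]; simp
  have hfin := hlow.trans_lt (ht q hq0)
  have hfin' : (s : ℝ) * (q - 1) - 1 < t * q := by exact_mod_cast hfin
  have : q * (t - s) = -(s + 1) := by rw [hq]; field_simp
  linarith

theorem assouadDim_support_le_upperRegDim [OpensMeasurableSpace X] [IsProbabilityMeasure μ] :
    assouadDim μ.support ≤ upperRegDim μ := by
  refine le_iInf₂ fun s ⟨C, hC, h⟩ => iInf₂_le s ⟨C * 6 ^ (s : ℝ), by positivity, ?_⟩
  intro r R hr hrR x hx
  have hR : 0 < R := hr.trans hrR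
  -- Balls of radius `r/2` about `r`-separated points `y` are disjoint inside `B(x,2R) ⊆ B(y,3R)`;
  -- the ratio `3R/(r/2)` produces the factor `6^s`.
  have hbound : packingNumber r.toNNReal (μ.support ∩ ball x R) ≤
      (⌊C * 6 ^ (s : ℝ) * (R / r) ^ (s : ℝ)⌋₊ : ℕ∞) := by
    refine iSup_le fun D => iSup₂_le fun hD hsep => ?_
    have hfinite : ∀ S : Finset X, (S : Set X) ⊆ D →
        S.card ≤ ⌊C * 6 ^ (s : ℝ) * (R / r) ^ (s : ℝ)⌋₊ := by
      intro S hS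
      refine Nat.le_floor ?_
      have hpos : 0 < μ.real (ball x (2 * R)) :=
        ENNReal.toReal_pos (measure_ball_pos_of_mem_support hx (by positivity)).ne'
          (measure_ne_top _ _)
      have hK : 0 < C * (3 * R / (r / 2)) ^ (s : ℝ) := by positivity
      have hcard : (S.card : ℝ) * ((C * (3 * R / (r / 2)) ^ (s : ℝ))⁻¹ *
          μ.real (ball x (2 * R))) ≤ μ.real (ball x (2 * R)) := by
        refine card_mul_le_measureReal (ρ := r / 2) (fun y hy z hz hyz => ?_) (fun y hy => ?_)
          (fun y hy => ?_)
        · have := hsep (hS hy) (hS hz) hyz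
          beta_reduce at this
          rw [edist_dist, ← ENNReal.ofReal, ENNReal.ofReal_lt_ofReal_iff_of_nonneg hr.le] at this
          linarith
        · have := mem_ball.1 (hD (hS hy)).2
          exact ball_subset_ball' (by linarith)
        · have hyx := mem_ball.1 (hD (hS hy)).2
          rw [dist_comm] at hyx
          have h1 := measure_ball_le_mul_of_div_le h (half_pos hr)
            (by linarith : r / 2 < 3 * R) (hD (hS hy)).1
          rw [inv_mul_le_iff₀ hK]
          exact (measureReal_mono (ball_subset_ball' (by linarith))).trans h1
      rw [← mul_assoc] at hcard
      have h2 := (mul_le_iff_le_one_left hpos).1 hcard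
      rw [mul_inv_le_iff₀ hK, one_mul] at h2
      refine h2.trans_eq ?_
      rw [mul_assoc, ← Real.mul_rpow (by positivity) (by positivity)]
      congr 2
      field_simp
      ring
    -- A separated set might be infinite, so a finite subset with one point too many is extracted.
    by_contra! hlt
    obtain ⟨E, hED, hE⟩ := Set.exists_subset_encard_eq (Order.add_one_le_of_lt hlt)
    have hEfin : E.Finite := Set.finite_of_encard_eq_coe (k := _ + 1) (by exact_mod_cast hE)
    have := hfinite hEfin.toFinset (by simpa using hED)
    rw [hEfin.encard_eq_coe_toFinset_card] at hE
    have hE' : hEfin.toFinset.card =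
        ⌊C * 6 ^ (s : ℝ) * (R / r) ^ (s : ℝ)⌋₊ + 1 := by exact_mod_cast hE
    omega
  have h3 := ((externalCoveringNumber_le_coveringNumber _ _).trans
    (coveringNumber_le_packingNumber _ _)).trans hbound
  calc ((externalCoveringNumber r.toNNReal (μ.support ∩ ball x R) : ℕ∞) : ℝ≥0∞)
      ≤ ((⌊C * 6 ^ (s : ℝ) * (R / r) ^ (s : ℝ)⌋₊ : ℕ∞) : ℝ≥0∞) := by exact_mod_cast h3
    _ ≤ ENNReal.ofReal (C * 6 ^ (s : ℝ) * (R / r) ^ (s : ℝ)) := by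
      rw [ENat.toENNReal_coe, ← ENNReal.ofReal_natCast]
      exact ENNReal.ofReal_le_ofReal (Nat.floor_le (by positivity))

end Metric

/-! ### Packing measures -/

section Packing

variable {X : Type*} [PseudoMetricSpace X]

theorem packingPreAt_mono_set (s δ : ℝ) {E F : Set X} (h : E ⊆ F) :
    packingPreAt s δ E ≤ packingPreAt s δ F :=
  iSup_le fun P => iSup₂_le fun hP hdisj =>
    le_iSup_of_le P (le_iSup₂_of_le (fun p hp => ⟨h (hP p hp).1, (hP p hp).2⟩) hdisj le_rfl)

theorem packingPremeasure_mono_set (s : ℝ) {E F : Set X} (h : E ⊆ F) :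
    packingPremeasure s E ≤ packingPremeasure s F :=
  iInf₂_mono fun δ _ => packingPreAt_mono_set s δ h

theorem packingPremeasure_empty (s : ℝ) : packingPremeasure s (∅ : Set X) = 0 := by
  refine le_antisymm (iInf₂_le_of_le 1 one_pos (iSup_le fun P => iSup₂_le fun hP _ => ?_)) bot_le
  rw [Finset.eq_empty_of_forall_notMem fun p hp => (hP p hp).1]
  simp

theorem packingMeasure_le_packingPremeasure (s : ℝ) (F : Set X) :
    packingMeasure s F ≤ packingPremeasure s F := by
  refine iInf₂_le_of_le (fun i => if i = 0 then F else ∅)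
    (fun x hx => mem_iUnion.2 ⟨0, by simpa using hx⟩) ?_
  rw [tsum_eq_single 0 fun i hi => by simp [hi, packingPremeasure_empty]]
  simp

theorem packingMeasure_mono_set (s : ℝ) {E F : Set X} (h : E ⊆ F) :
    packingMeasure s E ≤ packingMeasure s F :=
  iInf_mono fun _ => iInf_mono' fun hF => ⟨h.trans hF, le_rfl⟩

section Measure

variable [MeasurableSpace X] {μ : Measure X}

/-- Vitali selects disjoint balls whose fivefold enlargements cover `E`. Open balls of radius `6r`
contain these, and `(6r)^s = 3^s (2r)^s`. -/
theorem measure_le_mul_packingPreAt [TopologicalSpace.SeparableSpace X] {s δ : ℝ} (hδ : 0 < δ) {E : Set X}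
    (hE : ∀ x ∈ E, (s : EReal) < upperLocalDim μ x) :
    μ E ≤ ENNReal.ofReal (3 ^ s) * packingPreAt s δ E := by
  have hex : ∀ x ∈ E, ∃ r, 0 < r ∧ r ≤ min δ 1 ∧
      μ (ball x (6 * r)) ≤ ENNReal.ofReal ((6 * r) ^ s) := fun x hx => by
    obtain ⟨r, hr, hrδ, hr1, h⟩ := exists_ball_lt_rpow (hE x hx) (by positivity : 0 < 6 * δ)
    refine ⟨r / 6, by positivity, le_min (by linarith) (by linarith), ?_⟩
    rw [mul_div_cancel₀ r (by norm_num : (6 : ℝ) ≠ 0)]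
    exact h.le
  choose! r hr hrδ hμr using hex
  obtain ⟨u, huE, hdisj, hcov⟩ := Vitali.exists_disjoint_subfamily_covering_enlargement_closedBall
    E id r 1 (fun x hx => (hrδ x hx).trans (min_le_right _ _)) 5 (by norm_num)
  have hu : u.Countable := hdisj.countable_of_nonempty_interior fun x hx =>
    ⟨x, interior_mono ball_subset_closedBall (by
      rw [isOpen_ball.interior_eq]; exact mem_ball_self (hr x (huE hx)))⟩
  have hsub : E ⊆ ⋃ x ∈ u, ball x (6 * r x) := fun x hx => by
    obtain ⟨b, hb, hxb⟩ := hcov x hx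
    refine mem_iUnion₂.2 ⟨b, hb, closedBall_subset_ball ?_
      (hxb (mem_closedBall_self (hr x hx).le))⟩
    linarith [hr b (huE hb)]
  calc μ E ≤ ∑' x : u, μ (ball (x : X) (6 * r x)) :=
        (measure_mono hsub).trans (measure_biUnion_le μ hu _)
    _ ≤ ∑' x : u, ENNReal.ofReal (3 ^ s) * ENNReal.ofReal ((2 * r x) ^ s) := by
        refine ENNReal.tsum_le_tsum fun x => (hμr x (huE x.2)).trans_eq ?_
        rw [← ENNReal.ofReal_mul (by positivity), ← Real.mul_rpow (by norm_num)
          (by linarith [hr x (huE x.2)])]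
        ring_nf
    _ = ENNReal.ofReal (3 ^ s) * ∑' x : u, ENNReal.ofReal ((2 * r x) ^ s) :=
        ENNReal.tsum_mul_left
    _ ≤ _ := by
        gcongr
        rw [ENNReal.tsum_eq_iSup_sum]
        refine iSup_le fun T => ?_
        classical
        have hinj : Function.Injective fun x : u => ((x : X), r x) := fun x y hxy =>
          Subtype.ext (Prod.ext_iff.1 hxy).1
        refine le_iSup_of_le (T.map ⟨_, hinj⟩) (le_iSup₂_of_le ?_ ?_ (by simp))
        · intro p hp
          obtain ⟨x, -, rfl⟩ := Finset.mem_map.1 hp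
          exact ⟨huE x.2, hr x (huE x.2), (hrδ x (huE x.2)).trans (min_le_left _ _)⟩
        · intro p hp p' hp' hne
          obtain ⟨x, -, rfl⟩ := Finset.mem_map.1 hp
          obtain ⟨y, -, rfl⟩ := Finset.mem_map.1 hp'
          exact hdisj x.2 y.2 fun h => hne (by rw [Subtype.ext h])

theorem measure_le_mul_packingPremeasure [TopologicalSpace.SeparableSpace X] {s : ℝ} {E : Set X}
    (hE : ∀ x ∈ E, (s : EReal) < upperLocalDim μ x) :
    μ E ≤ ENNReal.ofReal (3 ^ s) * packingPremeasure s E := by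
  rw [← ENNReal.div_le_iff' (by simp; positivity) ENNReal.ofReal_ne_top]
  refine le_iInf₂ fun δ hδ => ?_
  rw [ENNReal.div_le_iff' (by simp; positivity) ENNReal.ofReal_ne_top]
  exact measure_le_mul_packingPreAt hδ hE

theorem measure_le_mul_packingMeasure [TopologicalSpace.SeparableSpace X] {s : ℝ} {F : Set X}
    (hF : ∀ x ∈ F, (s : EReal) < upperLocalDim μ x) :
    μ F ≤ ENNReal.ofReal (3 ^ s) * packingMeasure s F := by
  rw [← ENNReal.div_le_iff' (by simp; positivity) ENNReal.ofReal_ne_top]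
  refine le_iInf₂ fun E hE => ?_
  rw [ENNReal.div_le_iff' (by simp; positivity) ENNReal.ofReal_ne_top]
  -- The pieces of the cover are cut down to `F`, where the local dimension is controlled; they need
  -- not be measurable.
  calc μ F ≤ ∑' i, μ (E i ∩ F) := by
        refine (measure_mono ?_).trans (measure_iUnion_le _)
        rw [← iUnion_inter]
        exact subset_inter hE subset_rfl
    _ ≤ ∑' i, ENNReal.ofReal (3 ^ s) * packingPremeasure s (E i) :=
        ENNReal.tsum_le_tsum fun i =>
          (measure_le_mul_packingPremeasure fun x hx => hF x hx.2).trans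
            (by gcongr; exact packingPremeasure_mono_set s inter_subset_left)
    _ = _ := ENNReal.tsum_mul_left

theorem upperPackingDimMeasure_le_packingDim [OpensMeasurableSpace X]
    [TopologicalSpace.SeparableSpace X] :
    upperPackingDimMeasure μ ≤ (packingDim μ.support : EReal) := by
  refine EReal.le_coe_iInf_of_forall fun s hs => essSup_le_of_ae_le _ ?_
  change ∀ᵐ x ∂μ.restrict μ.support, upperLocalDim μ x ≤ ((s : ℝ) : EReal)
  rw [ae_restrict_iff' Measure.isClosed_support.measurableSet, ae_iff]
  push Not
  refine le_antisymm ((measure_le_mul_packingMeasure (s := s) fun x hx => hx.2).trans ?_) bot_le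
  refine (mul_le_mul_right (packingMeasure_mono_set (F := μ.support) _ fun x hx => hx.1) _).trans ?_
  rw [hs, mul_zero]

end Measure

/-- Disjointness keeps each centre out of the other balls, so centres are more than `2ρ` apart and
no `ρ`-ball covers two of them. -/
theorem card_packing_le_externalCoveringNumber {F : Set X} {ρ : ℝ≥0} {P : Finset (X × ℝ)}
    (hP : ∀ p ∈ P, p.1 ∈ F ∧ 2 * ρ < p.2)
    (hdisj : (P : Set (X × ℝ)).Pairwise
      fun p p' => Disjoint (closedBall p.1 p.2) (closedBall p'.1 p'.2)) :
    (P.card : ℕ∞) ≤ externalCoveringNumber ρ F := by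
  have hdist : ∀ p ∈ P, ∀ p' ∈ P, p ≠ p' → p.2 < dist p.1 p'.1 := by
    intro p hp p' hp' hne
    by_contra! hle
    refine disjoint_left.1 (hdisj hp hp' hne) (mem_closedBall'.2 hle) (mem_closedBall_self ?_)
    linarith [(hP p' hp').2, ρ.coe_nonneg]
  have hinj : InjOn Prod.fst (P : Set (X × ℝ)) := fun p hp p' hp' h => by
    by_contra hne
    have := hdist p hp p' hp' hne
    rw [h, dist_self] at this
    linarith [(hP p hp).2, ρ.coe_nonneg]
  rw [← encard_coe_eq_coe_finsetCard, ← hinj.encard_image]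
  refine le_trans ?_ (packingNumber_two_mul_le_externalCoveringNumber ρ F)
  refine IsSeparated.encard_le_packingNumber (image_subset_iff.2 fun p hp => (hP p hp).1) ?_
  rintro _ ⟨p, hp, rfl⟩ _ ⟨p', hp', rfl⟩ hne
  have h1 := hdist p hp p' hp' fun h => hne (by rw [h])
  have h2 := (hP p hp).2
  change ((2 * ρ : ℝ≥0) : ℝ≥0∞) < edist p.1 p'.1
  rw [edist_nndist, ENNReal.coe_lt_coe, ← NNReal.coe_lt_coe, coe_nndist]
  push_cast
  linarith

/-- Radii in `(2^-(k+1), 2^-k]` exceed `2ρ` for `ρ = 2^-(k+2)`; `δ ≤ 1` lets the scales start at `k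
= 0`. -/
theorem packingPreAt_le_tsum_externalCoveringNumber {t δ : ℝ} (ht : 0 ≤ t) (hδ : δ ≤ 1)
    (F : Set X) : packingPreAt t δ F ≤ ∑' k : ℕ,
      ((externalCoveringNumber ((1 / 2) ^ (k + 2)) F : ℕ∞) : ℝ≥0∞) *
        ENNReal.ofReal ((2 * (1 / 2) ^ k) ^ t) := by
  refine iSup_le fun P => iSup₂_le fun hP hdisj => ?_
  have hlevel : ∀ p ∈ P, ∃ k : ℕ, (1 / 2 : ℝ) ^ (k + 1) < p.2 ∧ p.2 ≤ (1 / 2) ^ k := fun p hp =>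
    exists_nat_pow_near_of_lt_one (hP p hp).2.1 ((hP p hp).2.2.trans hδ) (by norm_num)
      (by norm_num)
  choose! k hk1 hk2 using hlevel
  classical
  rw [← Finset.sum_fiberwise_of_maps_to (t := P.image k) (g := k)
    fun p hp => Finset.mem_image_of_mem k hp]
  refine (Finset.sum_le_sum fun n _ => ?_).trans (ENNReal.sum_le_tsum (P.image k))
  calc ∑ p ∈ P with k p = n, ENNReal.ofReal ((2 * p.2) ^ t)
      ≤ ∑ p ∈ P with k p = n, ENNReal.ofReal ((2 * (1 / 2) ^ n) ^ t) := by
        refine Finset.sum_le_sum fun p hp => ENNReal.ofReal_le_ofReal ?_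
        obtain ⟨hpP, rfl⟩ := Finset.mem_filter.1 hp
        have := (hP p hpP).2.1
        have := hk2 p hpP
        gcongr
    _ = ((P.filter fun p => k p = n).card : ℝ≥0∞) * ENNReal.ofReal ((2 * (1 / 2) ^ n) ^ t) := by
        rw [Finset.sum_const, nsmul_eq_mul]
    _ ≤ _ := by
        gcongr
        have := card_packing_le_externalCoveringNumber (F := F) (ρ := (1 / 2) ^ (n + 2))
          (P := P.filter fun p => k p = n) (fun p hp => ?_) 
          (hdisj.mono fun p hp => (Finset.mem_filter.1 hp).1)
        · simpa using ENat.toENNReal_le.2 this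
        · obtain ⟨hpP, rfl⟩ := Finset.mem_filter.1 hp
          refine ⟨(hP p hpP).1, lt_of_eq_of_lt ?_ (hk1 p hpP)⟩
          push_cast
          ring

theorem packingPreAt_le_rpow_mul {t t' δ : ℝ} (ht : t ≤ t') (F : Set X) :
    packingPreAt t' δ F ≤ ENNReal.ofReal ((2 * δ) ^ (t' - t)) * packingPreAt t δ F := by
  refine iSup_le fun P => iSup₂_le fun hP hdisj => ?_
  calc ∑ p ∈ P, ENNReal.ofReal ((2 * p.2) ^ t')
      ≤ ∑ p ∈ P, ENNReal.ofReal ((2 * δ) ^ (t' - t)) * ENNReal.ofReal ((2 * p.2) ^ t) := by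
        refine Finset.sum_le_sum fun p hp => ?_
        obtain ⟨-, hp0, hpδ⟩ := hP p hp
        have : 0 < δ := hp0.trans_le hpδ
        rw [← ENNReal.ofReal_mul (by positivity)]
        refine ENNReal.ofReal_le_ofReal ?_
        calc (2 * p.2) ^ t' = (2 * p.2) ^ (t' - t) * (2 * p.2) ^ t := by
              rw [← Real.rpow_add (by positivity), sub_add_cancel]
          _ ≤ _ := by gcongr
    _ = ENNReal.ofReal ((2 * δ) ^ (t' - t)) * ∑ p ∈ P, ENNReal.ofReal ((2 * p.2) ^ t) :=
        (Finset.mul_sum _ _ _).symm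
    _ ≤ _ := by
        gcongr
        exact le_iSup_of_le P (le_iSup₂_of_le hP hdisj le_rfl)

/-- Raising the exponent gains `(2δ)^(t'-t)`, which tends to `0`. -/
theorem packingPremeasure_eq_zero_of_lt {t t' : ℝ} (ht : t < t') {F : Set X} {K : ℝ≥0∞}
    (hK : K ≠ ∞) (h : ∀ δ ≤ 1, packingPreAt t δ F ≤ K) : packingPremeasure t' F = 0 := by
  refine le_antisymm ?_ bot_le
  have hlim : Tendsto (fun δ : ℝ => ENNReal.ofReal ((2 * δ) ^ (t' - t)) * K) (𝓝[>] 0) (𝓝 0) := by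
    have h1 : Tendsto (fun δ : ℝ => (2 * δ) ^ (t' - t)) (𝓝[>] 0) (𝓝 0) := by
      have : ContinuousAt (fun δ : ℝ => (2 * δ) ^ (t' - t)) 0 :=
        (continuousAt_const.mul continuousAt_id).rpow_const (Or.inr (sub_pos.2 ht).le)
      have h0 := this.tendsto
      simp only [mul_zero, Real.zero_rpow (sub_pos.2 ht).ne'] at h0
      exact h0.mono_left nhdsWithin_le_nhds
    have h2 := ENNReal.Tendsto.mul_const (b := K) (ENNReal.tendsto_ofReal h1) (Or.inr hK)
    simpa using h2
  refine ge_of_tendsto hlim ?_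
  filter_upwards [Ioo_mem_nhdsGT (one_pos (α := ℝ))] with δ hδ
  exact (iInf₂_le δ hδ.1).trans ((packingPreAt_le_rpow_mul ht.le F).trans
    (by gcongr; exact h δ hδ.2.le))

theorem packingDim_le_assouadDim {F : Set X} (hF : Bornology.IsBounded F) :
    packingDim F ≤ assouadDim F := by
  refine le_iInf₂ fun s ⟨C, hC, h⟩ => ENNReal.le_of_forall_pos_le_add fun ε hε _ => ?_
  rw [← ENNReal.coe_add]
  refine iInf₂_le_of_le (s + ε)
    (le_antisymm ((packingMeasure_le_packingPremeasure _ _).trans_eq ?_) bot_le) le_rfl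
  rcases F.eq_empty_or_nonempty with rfl | ⟨x, hx⟩
  · exact packingPremeasure_empty _
  -- `R > 1` keeps every dyadic scale below `R`.
  obtain ⟨R, hR, hsub⟩ := hF.subset_ball_lt 1 x
  -- Half of `ε` makes the sum over scales converge; the other half sends the premeasure to zero.
  have hR0 : 0 < R := one_pos.trans hR
  set t : ℝ := s + ε / 2 with ht
  have hε' : (0 : ℝ) < ε := hε
  have ht0 : 0 ≤ t := by positivity
  refine packingPremeasure_eq_zero_of_lt (t := t) (by push_cast; linarith) (K := ∑' k : ℕ,
    ENNReal.ofReal (C * (4 * R) ^ (s : ℝ) * 2 ^ t) *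
      ENNReal.ofReal ((1 / 2 : ℝ) ^ (ε / 2 : ℝ)) ^ k) ?_ fun δ hδ =>
    (packingPreAt_le_tsum_externalCoveringNumber ht0 hδ F).trans (ENNReal.tsum_le_tsum fun k => ?_)
  · rw [ENNReal.tsum_mul_left, ENNReal.tsum_geometric]
    refine ENNReal.mul_ne_top ENNReal.ofReal_ne_top (ENNReal.inv_ne_top.2 (tsub_pos_of_lt ?_).ne')
    rw [ENNReal.ofReal_lt_one]
    exact Real.rpow_lt_one (by norm_num) (by norm_num) (by positivity)
  · have hk := h ((1 / 2) ^ (k + 2)) R (by positivity)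
      ((pow_le_one₀ (by norm_num) (by norm_num)).trans_lt hR) x hx
    rw [inter_eq_left.2 hsub, Real.toNNReal_pow (by norm_num)] at hk
    have h2 : (1 / 2 : ℝ).toNNReal = 1 / 2 := by
      rw [← NNReal.coe_inj]; simp
    rw [h2] at hk
    refine (mul_le_mul_left hk _).trans_eq ?_
    rw [← ENNReal.ofReal_pow (by positivity), ← ENNReal.ofReal_mul (by positivity),
      ← ENNReal.ofReal_mul (by positivity)]
    congr 1
    have e1 : R / (1 / 2) ^ (k + 2) = 4 * R * ((1 / 2 : ℝ) ^ k)⁻¹ := by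
      field_simp
      ring
    rw [e1, Real.mul_rpow (by positivity) (by positivity),
      Real.mul_rpow (x := 2) (by positivity) (by positivity),
      Real.inv_rpow (by positivity), ht, Real.rpow_add (x := (1 / 2 : ℝ) ^ k) (by positivity),
      Real.rpow_pow_comm (x := 1 / 2) (by norm_num) (ε / 2 : ℝ) k]
    have : (0 : ℝ) < ((1 / 2 : ℝ) ^ k) ^ (s : ℝ) := by positivity
    field_simp

end Packing

theorem upperPackingDimMeasure_le_iSup_upperLocalDim {X : Type*} [PseudoMetricSpace X]
    [MeasurableSpace X] [OpensMeasurableSpace X] (μ : Measure X) :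
    upperPackingDimMeasure μ ≤ ⨆ x ∈ μ.support, upperLocalDim μ x := by
  refine essSup_le_of_ae_le _ ?_
  filter_upwards [ae_restrict_mem Measure.isClosed_support.measurableSet] with x hx
  exact le_iSup₂_of_le x hx le_rfl

theorem theorem2p1 (d : ℕ) (μ : Measure (EuclideanSpace ℝ (Fin d))) [IsProbabilityMeasure μ]
    (hμ : IsCompact μ.support) :
    (upperPackingDimMeasure μ ≤ ⨆ x ∈ μ.support, upperLocalDim μ x) ∧
    (⨆ x ∈ μ.support, upperLocalDim μ x) ≤ (topOfSpectrum μ : EReal) ∧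
    topOfSpectrum μ ≤ upperRegDim μ ∧
    upperPackingDimMeasure μ ≤ (packingDim μ.support : EReal) ∧
    packingDim μ.support ≤ assouadDim μ.support ∧
    assouadDim μ.support ≤ upperRegDim μ :=
  ⟨upperPackingDimMeasure_le_iSup_upperLocalDim μ,
    iSup₂_le fun _ hx => upperLocalDim_le_topOfSpectrum hx,
    topOfSpectrum_le_upperRegDim hμ.isBounded,
    upperPackingDimMeasure_le_packingDim,
    packingDim_le_assouadDim hμ.isBounded,
    assouadDim_support_le_upperRegDim⟩
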